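/- Let $X$ be a countably infinite set, let $P,\widehat P:X\times X\to[0,1]$ be sub-probability kernels ($\sum_{y}P(x,y)\le 1$, $\sum_y\widehat P(x,y)\le 1$ for all $x$) and let $\mu:X\to(0,\infty)$ be such that $\mu(x)P(x,y)=\mu(y)\widehat P(y,x)$ for all $x,y\in X$. Put $p(x,y)=P(x,y)/\mu(y)$ and $\widehat p(x,y)=\widehat P(x,y)/\mu(y)$. Let $V:X\to(0,\infty)$ satisfy $\inf_X V>0$. Assume: (A1) $P(x,y)>0$ for all $x,y\in X$, and $C_*\ge 1$ is a constant such that $\sum_{z\in X}P(x,z)P(z,y)\le C_*P(x,y)$ for all $x,y\in X$; (A2) $C_-:=\inf_{x\in X}P(x,x)>0$; (A3) $\sup_{x,y\in X}p(x,y)<\infty$; (B) for every $M\in\mathbb N$ there is a finite set $F\subset X$ with $V(x)\ge M$ for all $x\in X\setminus F$. Consider the bounded operators $$\mathcal Uf(x)=\frac1{V(x)}\sum_{y\in X}P(x,y)f(y),\qquad \widehat{\mathcal U}f(x)=\sum_{y\in X}\widehat P(x,y)\frac1{V(y)}f(y)$$ on the complex space $\ell^2(X,\mu)$. Let $\lambda_0=\sup\{|\lambda|:\lambda\in\sigma(\mathcal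 U)\}$ and let $\varphi_0$, $\widehat\varphi_0$ be the ground states of $\mathcal U$ and $\widehat{\mathcal U}$, i.e. the strictly positive eigenfunctions with $\|\varphi_0\|_{\ell^2(\mu)}=\|\widehat\varphi_0\|_{\ell^2(\mu)}=1$ whose eigenvalue is the spectral radius of the operator (this is $\lambda_0$ for both). Let $u_n$ and $\widehat u_n$, $n\ge1$, be the kernels with respect to $\mu$ of $\mathcal U^n$ and $\widehat{\mathcal U}^n$, that is, $u_1(x,y)=p(x,y)/V(x)$, $\widehat u_1(x,y)=\widehat p(x,y)/V(y)$, and $$u_{n+1}(x,y)=\sum_{z\in X}u_1(x,z)u_n(z,y)\mu(z),\qquad \widehat u_{n+1}(x,y)=\sum_{z\in X}\widehat u_1(x,z)\widehat u_n(z,y)\mu(z).$$ A sequence $(A_n)_{n\ge1}$ of subsets of $X$ is called exhausting if $A_n\subseteq A_{n+1}$ for all $n\ge 1$ and $\bigcup_nA_n=X$. The semigroup $\{\mathcal U^n\}$ is called progressively intrinsically ultracontractive (pIUC) with respect to an exhausting sequence $(A_n)_{n\ge1}$ if there are $n_0\ge 1$ and $c>0$ such that $u_n(x,y)\le c\lambda_0^n\varphi_0(x)\widehat\varphi_0(y)$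 for all $n\ge n_0$, $x\in A_n$, $y\in X$; similarly, $\{\widehat{\mathcal U}^n\}$ is pIUC with respect to $(A_n)_{n\ge1}$ if $\widehat u_n(x,y)\le c\lambda_0^n\widehat\varphi_0(x)\varphi_0(y)$ for all $n\ge n_0$, $x\in A_n$, $y\in X$, for some $n_0\ge 1$ and $c>0$. Let $(B_n)_{n\ge1}$ be an exhausting sequence of finite sets with respect to which $V$ is increasing: $V(x)\le V(y)$ whenever $\alpha(x)<\alpha(y)$, where $\alpha(x)=\min\{n\ge1:x\in B_n\}$. Put $B_\infty=X$, fix $x_0\in X$, let $C=\max\{3C_*,C_-^{-1}\}$, and let $D\supseteq\{z\in X:\lambda_0V(z)\le C\}$ be a finite set. Define $$D_n=D\cup\Big\{z\in X:\lambda_0V(z)\ge C\Big(\frac1{P(z,x_0)P(x_0,z)}\Big)^{1/(n-1)}\Big\},\quad n\ge2,$$ $$A_1=B_1,\qquad A_n=B_{l(n)},\quad l(n)=\sup\{k\ge1:B_k\subseteq D_n\}\in\{1,2,\dots\}\cup\{\infty\},\quad n\ge2\qquad(\sup\emptyset:=1).$$ Theorem. The sequence $(A_n)_{n\ge1}$ is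 exhausting, and there is a constant $c>0$ such that $$u_n(x,y)\le c\,\lambda_0^n\,\varphi_0(x)\,\widehat\varphi_0(y)\qquad\text{for all } n\ge1\text{ and all } x,y\in X\text{ with } x\in A_n\text{ or }y\in A_n.$$ In particular, both semigroups $\{\mathcal U^n\}$ and $\{\widehat{\mathcal U}^n\}$ are pIUC with respect to $(A_n)_{n\ge1}$. -/

import Mathlib

open MeasureTheory
open scoped ENNReal NNReal

/-- The measure on `X` with point masses `μ x`. -/
noncomputable def weightMeasure {X : Type*} [MeasurableSpace X] (μ : X → ℝ) : Measure X :=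
  Measure.sum fun x => ENNReal.ofReal (μ x) • Measure.dirac x

/-- The complex Hilbert space `ℓ²(X, μ)`. -/
noncomputable abbrev ell2 {X : Type*} [MeasurableSpace X] (μ : X → ℝ) :=
  Lp ℂ 2 (weightMeasure μ)

/-- `(K f)(x) = ∑_y K(x,y) f(y)`. -/
noncomputable def kernelApply {X : Type*} (K : X → X → ℝ) (f : X → ℂ) (x : X) : ℂ :=
  ∑' y, (K x y : ℂ) * f y

/-- A nonnegative kernel whose row sums, and whose row sums after transposition with respect to
`μ`, are at most `C`. Such a kernel acts boundedly on `ℓ²(X, μ)`. -/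
structure SchurBound {X : Type*} (μ : X → ℝ) (K : X → X → ℝ) (C : ℝ) : Prop where
  nonneg : ∀ x y, 0 ≤ K x y
  pos : ∀ x, 0 < μ x
  const_nonneg : 0 ≤ C
  row_summable : ∀ x, Summable fun y => K x y
  row_le : ∀ x, ∑' y, K x y ≤ C
  col_summable : ∀ y, Summable fun x => μ x * K x y
  col_le : ∀ y, ∑' x, μ x * K x y ≤ C * μ y

section SchurTest

variable {X : Type*} [Countable X] [MeasurableSpace X] [DiscreteMeasurableSpace X]
  {μ : X → ℝ} {K : X → X → ℝ} {C : ℝ}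

theorem weightMeasure_singleton (x : X) :
    weightMeasure μ {x} = ENNReal.ofReal (μ x) := by
  exact Measure.sum_smul_dirac_singleton

theorem eq_of_ae_eq_weightMeasure (hμ : ∀ x, 0 < μ x) {E : Type*} {f g : X → E}
    (h : f =ᵐ[weightMeasure μ] g) : f = g := by
  have h' := ae_iff_of_countable.1 h
  funext x
  apply h' x
  rw [weightMeasure_singleton]
  simpa using hμ x

theorem eLpNorm_two_sq (f : X → ℂ) :
    eLpNorm f 2 (weightMeasure μ) ^ 2 = ∑' x, ENNReal.ofReal (μ x) * ‖f x‖ₑ ^ 2 := by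
  have h := eLpNorm_nnreal_pow_eq_lintegral (μ := weightMeasure μ) (f := f) (p := 2) two_ne_zero
  simp only [NNReal.coe_ofNat, ENNReal.rpow_ofNat, ENNReal.coe_ofNat] at h
  rw [h, lintegral_countable']
  simp_rw [weightMeasure_singleton, mul_comm]

theorem SchurBound.tsum_sq_le (h : SchurBound μ K C) (f : X → ℂ) (x : X) :
    (∑' y, ENNReal.ofReal (K x y) * ‖f y‖ₑ) ^ 2 ≤
      ENNReal.ofReal C * ∑' y, ENNReal.ofReal (K x y) * ‖f y‖ₑ ^ 2 := by
  have hrow : ∑' y, ENNReal.ofReal (K x y) ≤ ENNReal.ofReal C := by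
    rw [← ENNReal.ofReal_tsum_of_nonneg (h.nonneg x) (h.row_summable x)]
    exact ENNReal.ofReal_le_ofReal (h.row_le x)
  refine le_trans ?_ (mul_le_mul_left hrow _)
  have key := ENNReal.lintegral_mul_le_Lp_mul_Lq (Measure.count : Measure X)
    Real.HolderConjugate.two_two
    (f := fun y => ENNReal.ofReal (K x y) ^ (1 / 2 : ℝ))
    (g := fun y => ENNReal.ofReal (K x y) ^ (1 / 2 : ℝ) * ‖f y‖ₑ)
    (measurable_of_countable _).aemeasurable (measurable_of_countable _).aemeasurable
  simp only [lintegral_count, Pi.mul_apply] at key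
  have e1 : ∀ a : ℝ≥0∞, a ^ (1 / 2 : ℝ) * a ^ (1 / 2 : ℝ) = a := by
    intro a
    rw [← ENNReal.rpow_add_of_nonneg _ _ (by norm_num) (by norm_num)]
    norm_num
  have e2 : ∀ a : ℝ≥0∞, (a ^ (1 / 2 : ℝ)) ^ (2 : ℝ) = a := by
    intro a
    rw [← ENNReal.rpow_mul]
    norm_num
  simp only [← mul_assoc, e1, e2, ENNReal.mul_rpow_of_nonneg _ _ (by norm_num : (0 : ℝ) ≤ 2)]
    at key
  have := pow_le_pow_left' key 2
  simp only [ENNReal.rpow_ofNat, mul_pow] at this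
  have e3 : ∀ a : ℝ≥0∞, (a ^ (1 / 2 : ℝ)) ^ 2 = a := by
    intro a
    rw [← ENNReal.rpow_ofNat, e2]
  rwa [e3, e3] at this

theorem SchurBound.tsum_tsum_le (h : SchurBound μ K C) (f : X → ℂ) :
    ∑' x, ENNReal.ofReal (μ x) * (ENNReal.ofReal C * ∑' y, ENNReal.ofReal (K x y) * ‖f y‖ₑ ^ 2) ≤
      (ENNReal.ofReal C * eLpNorm f 2 (weightMeasure μ)) ^ 2 := by
  have hcol : ∀ y, ∑' x, ENNReal.ofReal (μ x) * ENNReal.ofReal (K x y) ≤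
      ENNReal.ofReal C * ENNReal.ofReal (μ y) := by
    intro y
    simp_rw [← ENNReal.ofReal_mul (h.pos _).le, ← ENNReal.ofReal_mul h.const_nonneg]
    rw [← ENNReal.ofReal_tsum_of_nonneg (fun x => mul_nonneg (h.pos x).le (h.nonneg x y))
      (h.col_summable y)]
    exact ENNReal.ofReal_le_ofReal (h.col_le y)
  calc ∑' x, ENNReal.ofReal (μ x) *
        (ENNReal.ofReal C * ∑' y, ENNReal.ofReal (K x y) * ‖f y‖ₑ ^ 2)
      = ENNReal.ofReal C * ∑' y, (∑' x, ENNReal.ofReal (μ x) * ENNReal.ofReal (K x y)) *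
          ‖f y‖ₑ ^ 2 := by
        simp_rw [← ENNReal.tsum_mul_left, ← ENNReal.tsum_mul_right]
        rw [ENNReal.tsum_comm]
        simp_rw [← ENNReal.tsum_mul_left]
        refine tsum_congr fun y => tsum_congr fun x => ?_
        ring
    _ ≤ ENNReal.ofReal C * ∑' y, (ENNReal.ofReal C * ENNReal.ofReal (μ y)) * ‖f y‖ₑ ^ 2 := by
        gcongr with y
        exact hcol y
    _ = (ENNReal.ofReal C * eLpNorm f 2 (weightMeasure μ)) ^ 2 := by
        rw [mul_pow, eLpNorm_two_sq]
        simp_rw [← ENNReal.tsum_mul_left]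
        refine tsum_congr fun y => ?_
        ring

theorem SchurBound.enorm_apply_le (h : SchurBound μ K C) (f : X → ℂ) (x : X) :
    ‖kernelApply K f x‖ₑ ≤ ∑' y, ENNReal.ofReal (K x y) * ‖f y‖ₑ := by
  refine (enorm_tsum_le_tsum_enorm).trans_eq ?_
  congr! 2 with y
  rw [enorm_mul]
  congr 1
  rw [← ofReal_norm, Complex.norm_real, Real.norm_of_nonneg (h.nonneg x y)]

theorem SchurBound.eLpNorm_le (h : SchurBound μ K C) (f : X → ℂ) :
    eLpNorm (kernelApply K f) 2 (weightMeasure μ) ≤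
      ENNReal.ofReal C * eLpNorm f 2 (weightMeasure μ) := by
  refine (ENNReal.pow_le_pow_left_iff two_ne_zero).1 ?_
  rw [eLpNorm_two_sq]
  refine le_trans ?_ (h.tsum_tsum_le f)
  gcongr with x
  exact (pow_le_pow_left' (h.enorm_apply_le f x) 2).trans (h.tsum_sq_le f x)

theorem SchurBound.memLp (h : SchurBound μ K C) {f : X → ℂ}
    (hf : MemLp f 2 (weightMeasure μ)) : MemLp (kernelApply K f) 2 (weightMeasure μ) :=
  ⟨(measurable_of_countable _).aestronglyMeasurable,
    (h.eLpNorm_le f).trans_lt (ENNReal.mul_lt_top ENNReal.ofReal_lt_top hf.2)⟩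

theorem SchurBound.summable (h : SchurBound μ K C) {f : X → ℂ}
    (hf : MemLp f 2 (weightMeasure μ)) (x : X) : Summable fun y => (K x y : ℂ) * f y := by
  have h1 : (ENNReal.ofReal C * eLpNorm f 2 (weightMeasure μ)) ^ 2 ≠ ∞ :=
    ENNReal.pow_ne_top (ENNReal.mul_ne_top ENNReal.ofReal_ne_top hf.2.ne)
  have h2 := ENNReal.ne_top_of_tsum_ne_top (ne_top_of_le_ne_top h1 (h.tsum_tsum_le f)) x
  have h3 : ENNReal.ofReal C * ∑' y, ENNReal.ofReal (K x y) * ‖f y‖ₑ ^ 2 ≠ ∞ := by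
    intro h4
    rw [h4, ENNReal.mul_top (by simpa using h.pos x)] at h2
    exact h2 rfl
  have h4 := ne_top_of_le_ne_top h3 (h.tsum_sq_le f x)
  have h5 : ∑' y, ENNReal.ofReal (K x y) * ‖f y‖ₑ ≠ ∞ := fun h6 => h4 (by simp [h6])
  have h6 : ∑' y, ‖(K x y : ℂ) * f y‖ₑ ≠ ∞ := by
    convert h5 using 3 with y
    rw [enorm_mul]
    congr 1
    rw [← ofReal_norm, Complex.norm_real, Real.norm_of_nonneg (h.nonneg x y)]
  exact (tsum_enorm_ne_top_iff_summable_norm.1 h6).of_norm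

/-- The bounded operator on `ℓ²(X, μ)` with kernel `K`. -/
noncomputable def SchurBound.toCLM (h : SchurBound μ K C) : ell2 μ →L[ℂ] ell2 μ :=
  LinearMap.mkContinuous
    { toFun := fun f => (h.memLp (Lp.memLp f)).toLp (kernelApply K f)
      map_add' := by
        intro f g
        rw [← MemLp.toLp_add]
        congr 1
        have : (↑↑(f + g) : X → ℂ) = ↑↑f + ↑↑g :=
          eq_of_ae_eq_weightMeasure h.pos (Lp.coeFn_add f g)
        funext x
        rw [this]
        simp only [kernelApply, Pi.add_apply, mul_add]
        exact (h.summable (Lp.memLp f) x).tsum_add (h.summable (Lp.memLp g) x)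
      map_smul' := by
        intro c f
        rw [RingHom.id_apply, ← MemLp.toLp_const_smul]
        congr 1
        have : (↑↑(c • f) : X → ℂ) = c • ↑↑f :=
          eq_of_ae_eq_weightMeasure h.pos (Lp.coeFn_smul c f)
        funext x
        rw [this]
        simp only [kernelApply, Pi.smul_apply, smul_eq_mul, ← tsum_mul_left]
        congr 1
        funext y
        ring }
    C (by
      intro f
      have h1 := ENNReal.toReal_mono
        (ENNReal.mul_ne_top ENNReal.ofReal_ne_top (Lp.eLpNorm_ne_top f)) (h.eLpNorm_le f)
      rw [ENNReal.toReal_mul, ENNReal.toReal_ofReal h.const_nonneg, ← Lp.norm_def] at h1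
      exact (Lp.norm_toLp _ (h.memLp (Lp.memLp f))).trans_le h1)

/-- The operator acts by the kernel, at every point. -/
theorem SchurBound.toCLM_apply (h : SchurBound μ K C) (f : ell2 μ) (x : X) :
    h.toCLM f x = ∑' y, (K x y : ℂ) * f y :=
  congrFun (eq_of_ae_eq_weightMeasure h.pos (MemLp.coeFn_toLp (h.memLp (Lp.memLp f)))) x

end SchurTest

/-- A Markov chain `P` on `X`, a chain `Phat` in duality with it with respect to the measure `μ`,
and a potential `V` that is bounded below by a positive constant. -/
structure FeynmanKac (X : Type*) where
  P : X → X → ℝ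
  Phat : X → X → ℝ
  μ : X → ℝ
  V : X → ℝ
  P_nonneg : ∀ x y, 0 ≤ P x y
  P_summable : ∀ x, Summable fun y => P x y
  P_sum_le : ∀ x, ∑' y, P x y ≤ 1
  Phat_nonneg : ∀ x y, 0 ≤ Phat x y
  Phat_summable : ∀ x, Summable fun y => Phat x y
  Phat_sum_le : ∀ x, ∑' y, Phat x y ≤ 1
  μ_pos : ∀ x, 0 < μ x
  duality : ∀ x y, μ x * P x y = μ y * Phat y x
  V_lower : ∃ v > 0, ∀ x, v ≤ V x

/-- `k_n`, where `k` is a kernel (a density with respect to `μ`): `k_0 = 𝟙_{x = y}`, `k_1 = k`,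
`k_{n+1}(x,y) = ∑_z k(x,z) k_n(z,y) μ(z)`. -/
noncomputable def iterKernel {X : Type*} (μ : X → ℝ) (k : X → X → ℝ) : ℕ → X → X → ℝ
  | 0 => fun x y => Set.indicator {x} (fun _ => 1) y
  | 1 => k
  | n + 2 => fun x y => ∑' z, k x z * iterKernel μ k (n + 1) z y * μ z

namespace FeynmanKac

variable {X : Type*}

/-- The transition density `p(x,y) = P(x,y) / μ(y)`. -/
noncomputable def p (S : FeynmanKac X) (x y : X) : ℝ := S.P x y / S.μ y

/-- The transition density of the dual chain. -/
noncomputable def phat (S : FeynmanKac X) (x y : X) : ℝ := S.Phat x y / S.μ y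

/-- The kernels `u_n` of the Feynman-Kac semigroup, `u_1(x,y) = p(x,y) / V(x)`. -/
noncomputable def u (S : FeynmanKac X) : ℕ → X → X → ℝ :=
  iterKernel S.μ fun x y => S.p x y / S.V x

/-- The kernels of the dual Feynman-Kac semigroup, with one-step kernel
`phat(x,y) / V(y)`. -/
noncomputable def uhat (S : FeynmanKac X) : ℕ → X → X → ℝ :=
  iterKernel S.μ fun x y => S.phat x y / S.V y

theorem V_pos (S : FeynmanKac X) (x : X) : 0 < S.V x := by
  obtain ⟨v, hv, h⟩ := S.V_lower
  exact hv.trans_le (h x)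

theorem schurBound_U (S : FeynmanKac X) :
    SchurBound S.μ (fun x y => S.P x y / S.V x) S.V_lower.choose⁻¹ := by
  obtain ⟨hv, h⟩ := S.V_lower.choose_spec
  set v := S.V_lower.choose
  have hle : ∀ x y, S.P x y / S.V x ≤ v⁻¹ * S.P x y := by
    intro x y
    rw [div_eq_inv_mul]
    exact mul_le_mul_of_nonneg_right (inv_anti₀ hv (h x)) (S.P_nonneg x y)
  have hnn : ∀ x y, 0 ≤ S.P x y / S.V x := fun x y =>
    div_nonneg (S.P_nonneg x y) (S.V_pos x).le
  have hrow : ∀ x, Summable fun y => S.P x y / S.V x := fun x => (S.P_summable x).div_const _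
  have hle2 : ∀ x y, S.μ x * (S.P x y / S.V x) ≤ v⁻¹ * S.μ y * S.Phat y x := by
    intro x y
    calc S.μ x * (S.P x y / S.V x) ≤ S.μ x * (v⁻¹ * S.P x y) :=
          mul_le_mul_of_nonneg_left (hle x y) (S.μ_pos x).le
      _ = v⁻¹ * (S.μ x * S.P x y) := by ring
      _ = v⁻¹ * S.μ y * S.Phat y x := by rw [S.duality]; ring
  have hcol : ∀ y, Summable fun x => S.μ x * (S.P x y / S.V x) := fun y =>
    Summable.of_nonneg_of_le (fun x => mul_nonneg (S.μ_pos x).le (hnn x y)) (fun x => hle2 x y)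
      ((S.Phat_summable y).mul_left _)
  refine ⟨hnn, S.μ_pos, inv_nonneg.2 hv.le, hrow, fun x => ?_, hcol, fun y => ?_⟩
  · calc ∑' y, S.P x y / S.V x ≤ ∑' y, v⁻¹ * S.P x y :=
          (hrow x).tsum_le_tsum (hle x) ((S.P_summable x).mul_left _)
      _ = v⁻¹ * ∑' y, S.P x y := tsum_mul_left
      _ ≤ v⁻¹ * 1 := mul_le_mul_of_nonneg_left (S.P_sum_le x) (inv_nonneg.2 hv.le)
      _ = v⁻¹ := mul_one _
  · calc ∑' x, S.μ x * (S.P x y / S.V x) ≤ ∑' x, v⁻¹ * S.μ y * S.Phat y x :=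
          (hcol y).tsum_le_tsum (fun x => hle2 x y) ((S.Phat_summable y).mul_left _)
      _ = v⁻¹ * S.μ y * ∑' x, S.Phat y x := tsum_mul_left
      _ ≤ v⁻¹ * S.μ y * 1 := mul_le_mul_of_nonneg_left (S.Phat_sum_le y)
          (mul_nonneg (inv_nonneg.2 hv.le) (S.μ_pos y).le)
      _ = v⁻¹ * S.μ y := mul_one _

theorem schurBound_Uhat (S : FeynmanKac X) :
    SchurBound S.μ (fun x y => S.Phat x y / S.V y) S.V_lower.choose⁻¹ := by
  obtain ⟨hv, h⟩ := S.V_lower.choose_spec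
  set v := S.V_lower.choose
  have hle : ∀ x y, S.Phat x y / S.V y ≤ v⁻¹ * S.Phat x y := by
    intro x y
    rw [div_eq_inv_mul]
    exact mul_le_mul_of_nonneg_right (inv_anti₀ hv (h y)) (S.Phat_nonneg x y)
  have hnn : ∀ x y, 0 ≤ S.Phat x y / S.V y := fun x y =>
    div_nonneg (S.Phat_nonneg x y) (S.V_pos y).le
  have hrow : ∀ x, Summable fun y => S.Phat x y / S.V y := fun x =>
    Summable.of_nonneg_of_le (hnn x) (hle x) ((S.Phat_summable x).mul_left _)
  have hle2 : ∀ x y, S.μ x * (S.Phat x y / S.V y) ≤ v⁻¹ * S.μ y * S.P y x := by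
    intro x y
    calc S.μ x * (S.Phat x y / S.V y) ≤ S.μ x * (v⁻¹ * S.Phat x y) :=
          mul_le_mul_of_nonneg_left (hle x y) (S.μ_pos x).le
      _ = v⁻¹ * (S.μ x * S.Phat x y) := by ring
      _ = v⁻¹ * S.μ y * S.P y x := by rw [← S.duality]; ring
  have hcol : ∀ y, Summable fun x => S.μ x * (S.Phat x y / S.V y) := fun y =>
    Summable.of_nonneg_of_le (fun x => mul_nonneg (S.μ_pos x).le (hnn x y)) (fun x => hle2 x y)
      ((S.P_summable y).mul_left _)
  refine ⟨hnn, S.μ_pos, inv_nonneg.2 hv.le, hrow, fun x => ?_, hcol, fun y => ?_⟩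
  · calc ∑' y, S.Phat x y / S.V y ≤ ∑' y, v⁻¹ * S.Phat x y :=
          (hrow x).tsum_le_tsum (hle x) ((S.Phat_summable x).mul_left _)
      _ = v⁻¹ * ∑' y, S.Phat x y := tsum_mul_left
      _ ≤ v⁻¹ * 1 := mul_le_mul_of_nonneg_left (S.Phat_sum_le x) (inv_nonneg.2 hv.le)
      _ = v⁻¹ := mul_one _
  · calc ∑' x, S.μ x * (S.Phat x y / S.V y) ≤ ∑' x, v⁻¹ * S.μ y * S.P y x :=
          (hcol y).tsum_le_tsum (fun x => hle2 x y) ((S.P_summable y).mul_left _)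
      _ = v⁻¹ * S.μ y * ∑' x, S.P y x := tsum_mul_left
      _ ≤ v⁻¹ * S.μ y * 1 := mul_le_mul_of_nonneg_left (S.P_sum_le y)
          (mul_nonneg (inv_nonneg.2 hv.le) (S.μ_pos y).le)
      _ = v⁻¹ * S.μ y := mul_one _

section Operators

variable [Countable X] [MeasurableSpace X] [DiscreteMeasurableSpace X]

/-- The Feynman-Kac operator `U f(x) = V(x)⁻¹ ∑_y P(x,y) f(y)` on `ℓ²(X, μ)`. -/
noncomputable def U (S : FeynmanKac X) : ell2 S.μ →L[ℂ] ell2 S.μ := S.schurBound_U.toCLM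

/-- The dual operator `f ↦ ∑_y Phat(x,y) V(y)⁻¹ f(y)` on `ℓ²(X, μ)`. -/
noncomputable def Uhat (S : FeynmanKac X) : ell2 S.μ →L[ℂ] ell2 S.μ := S.schurBound_Uhat.toCLM

/-- `λ₀ = sup {|λ| : λ ∈ σ(U)}`. -/
noncomputable def lam0 (S : FeynmanKac X) : ℝ := (spectralRadius ℂ S.U).toReal

end Operators

/-- The direct step property: `P > 0` and `P_2 ≤ Cs P` with a constant `Cs ≥ 1`. -/
def A1 (S : FeynmanKac X) (Cs : ℝ) : Prop :=
  1 ≤ Cs ∧ (∀ x y, 0 < S.P x y) ∧ ∀ x y, ∑' z, S.P x z * S.P z y ≤ Cs * S.P x y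

/-- `C₋ = inf_x P(x,x)`. -/
noncomputable def Cminus (S : FeynmanKac X) : ℝ := ⨅ x, S.P x x

/-- Uniform laziness. -/
def A2 (S : FeynmanKac X) : Prop := 0 < S.Cminus

/-- The transition densities are bounded. -/
def A3 (S : FeynmanKac X) : Prop := ∃ M : ℝ, ∀ x y, S.P x y / S.μ y ≤ M

/-- The potential is confining. -/
def Confining (S : FeynmanKac X) : Prop :=
  ∀ M : ℕ, ∃ B : Set X, B.Finite ∧ ∀ x, x ∉ B → (M : ℝ) ≤ S.V x

/-- `C = max {3 Cs, C₋⁻¹}`. -/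
noncomputable def constC (S : FeynmanKac X) (Cs : ℝ) : ℝ := max (3 * Cs) S.Cminus⁻¹

end FeynmanKac

/-- `φ` is the ground state of the operator `T` on `ℓ²(X, μ)`: the strictly positive
eigenfunction of norm one whose eigenvalue is the spectral radius of `T`. -/
def IsGroundState {X : Type*} [MeasurableSpace X] {μ : X → ℝ}
    (T : ell2 μ →L[ℂ] ell2 μ) (φ : X → ℝ) : Prop :=
  (∀ x, 0 < φ x) ∧ ∃ h : MemLp (fun x => (φ x : ℂ)) 2 (weightMeasure μ),
    ‖h.toLp‖ = 1 ∧ T h.toLp = ((spectralRadius ℂ T).toReal : ℂ) • h.toLp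

/-- `(A_n)_{n ≥ 1}` is exhausting; the index `0` plays no role. -/
def IsExhausting {X : Type*} (A : ℕ → Set X) : Prop :=
  (∀ n, 1 ≤ n → A n ⊆ A (n + 1)) ∧ ⋃ n ∈ Set.Ici 1, A n = Set.univ

/-- First appearance: the least `n ≥ 1` with `x ∈ A_n`. -/
noncomputable def firstAppearance {X : Type*} (A : ℕ → Set X) (x : X) : ℕ :=
  sInf {n | 1 ≤ n ∧ x ∈ A n}

/-- `V` is increasing with respect to the exhausting sequence `(A_n)_{n ≥ 1}`. -/
def IncreasingAlong {X : Type*} (V : X → ℝ) (A : ℕ → Set X) : Prop :=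
  ∀ x y, firstAppearance A x < firstAppearance A y → V x ≤ V y

/-- `(B_n)_{n ≥ 1}` extended by `B_∞ = X`. -/
noncomputable def extendTop {X : Type*} (B : ℕ → Set X) (k : ℕ∞) : Set X :=
  open Classical in if k = ⊤ then Set.univ else B k.toNat

/-- `sup {k ≥ 1 : B_k ⊆ E}` in `{1, 2, …, ∞}`, where the supremum of the empty set is `1`. -/
noncomputable def lastIndex {X : Type*} (B : ℕ → Set X) (E : Set X) : ℕ∞ :=
  open Classical in
  if ∃ k, 1 ≤ k ∧ B k ⊆ E then ⨆ k ∈ {k : ℕ | 1 ≤ k ∧ B k ⊆ E}, (k : ℕ∞) else 1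

/-- Progressive intrinsic ultracontractivity with respect to the exhausting sequence
`(A_n)_{n ≥ 1}` of the semigroup with kernels `k n`, where `φ` and `ψ` are the ground states of
the semigroup and of its dual, with eigenvalue `lam`. -/
def IsPIUCAlong {X : Type*} (A : ℕ → Set X) (k : ℕ → X → X → ℝ) (lam : ℝ) (φ ψ : X → ℝ) : Prop :=
  IsExhausting A ∧ ∃ n₀ : ℕ, 1 ≤ n₀ ∧ ∃ c : ℝ, 0 < c ∧
    ∀ n, n₀ ≤ n → ∀ x ∈ A n, ∀ y, k n x y ≤ c * lam ^ n * φ x * ψ y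

namespace FeynmanKac

variable {X : Type*} [Countable X] [MeasurableSpace X] [DiscreteMeasurableSpace X]

/-- `D_n = D ∪ {z : λ₀ V(z) ≥ C (1 / (P(z,x₀) P(x₀,z)))^{1/(n-1)}}`, used for `n ≥ 2`. -/
noncomputable def levelSet (S : FeynmanKac X) (Cs : ℝ) (D : Set X) (x₀ : X) (n : ℕ) : Set X :=
  D ∪ {z | S.lam0 * S.V z ≥
    S.constC Cs * (1 / (S.P z x₀ * S.P x₀ z)) ^ (1 / ((n : ℝ) - 1))}

/-- `A_1 = B_1` and `A_n = B_{l(n)}` for `n ≥ 2`, where `l(n) = sup {k : B_k ⊆ D_n}`. -/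
noncomputable def exhaustion (S : FeynmanKac X) (Cs : ℝ) (B : ℕ → Set X) (D : Set X) (x₀ : X)
    (n : ℕ) : Set X :=
  if n ≤ 1 then B 1 else extendTop B (lastIndex B (S.levelSet Cs D x₀ n))

end FeynmanKac

/-! Put m = 1/(λ₀V). Up to the factor λ₀^(n+1), the quantity u_{n+1}(x,y) μ(y) is m(x) times the sum
over paths from x to y with n intermediate points, each such point z weighted by m(z). The
transposed dual kernel has the same expression. So one bound on path sums by φ(x)ψ(y), with ψ =
φhat·μ, serves both semigroups. The eigenvalue equations say that φ and ψ are right and left fixed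
functions of the kernel m(x)P(x,y); duality makes the two eigenvalues equal.

If x or y lies in a fixed finite set, a single term of the fixed-point equation already gives the
bound (`pathSum.exists_le_of_finite`). Otherwise the paths are split at the first visit to the
finite set D (`pathSum.le_add_avoiding`). Off D one has 2·Cs·m ≤ 1, so by the direct step property
P(·,x₀) at least halves with each step avoiding D. The paths visiting D therefore contribute at most
a constant times P(x,x₀)ψ(y).

For the paths avoiding D, the direct step property concentrates all the weight at one point
(`pathSum.succ_le_tsum`), leaving (2Cs)^k ∑ P(x,z) m(z)^(k+1) P(z,y) over z outside D. The level
sets are chosen so that (2Cs)^k m(z)^(k+1) ≤ P(z,x₀)P(x₀,z) on them; there the direct step property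
turns the sum into a multiple of P(x,x₀)P(x₀,y). If z is not known to be in the level set,
monotonicity of V gives m(z) ≤ m(w) for the endpoint w in A_n, and the inequality at w is used
instead. Finally m(x)P(x,x₀) and P(x₀,y) are at most constants times φ(x) and ψ(y). -/

/-! ### Weighted path sums in `ℝ≥0∞`. -/

/-- The sum over all paths from `x` to `y` with `n` intermediate points, where a path is weighted
by the product of the transition weights `P` along it and of the weights `m` of its intermediate
points. -/
noncomputable def pathSum {X : Type*} (P : X → X → ℝ≥0∞) (m : X → ℝ≥0∞) : ℕ → X → X → ℝ≥0∞
  | 0 => P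
  | n + 1 => fun x y => ∑' z, P x z * (m z * pathSum P m n z y)

namespace pathSum

variable {X : Type*} {P : X → X → ℝ≥0∞} {m φ ψ : X → ℝ≥0∞} {Cs : ℝ≥0∞}

theorem succ_right (P : X → X → ℝ≥0∞) (m : X → ℝ≥0∞) (n : ℕ) (x y : X) :
    pathSum P m (n + 1) x y = ∑' z, pathSum P m n x z * (m z * P z y) := by
  induction n generalizing x y with
  | zero => rfl
  | succ n ih =>
    calc pathSum P m (n + 2) x y
        = ∑' z, P x z * (m z * ∑' w, pathSum P m n z w * (m w * P w y)) := by
          simp_rw [← ih]; rfl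
      _ = ∑' w, (∑' z, P x z * (m z * pathSum P m n z w)) * (m w * P w y) := by
          simp_rw [← ENNReal.tsum_mul_left, ← ENNReal.tsum_mul_right]
          rw [ENNReal.tsum_comm]
          refine tsum_congr fun w => tsum_congr fun z => ?_
          ring

/-- A left superharmonic function absorbs the first step of the path, so steps can be removed one at
a time from the left. -/
theorem tsum_left_le (hψ : ∀ y, ∑' x, ψ x * (m x * P x y) ≤ ψ y) (n : ℕ) (y : X) :
    ∑' x, ψ x * (m x * pathSum P m n x y) ≤ ψ y := by
  induction n with
  | zero => exact hψ y
  | succ n ih =>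
    calc ∑' x, ψ x * (m x * ∑' z, P x z * (m z * pathSum P m n z y))
        = ∑' z, (∑' x, ψ x * (m x * P x z)) * (m z * pathSum P m n z y) := by
          simp_rw [← ENNReal.tsum_mul_left, ← ENNReal.tsum_mul_right]
          rw [ENNReal.tsum_comm]
          refine tsum_congr fun w => tsum_congr fun z => ?_
          ring
      _ ≤ ∑' z, ψ z * (m z * pathSum P m n z y) := by
          gcongr with z
          exact hψ z
      _ ≤ ψ y := ih

theorem tsum_right_le (hφ : ∀ x, ∑' y, m x * P x y * φ y ≤ φ x) (n : ℕ) (x : X) :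
    ∑' y, m x * pathSum P m n x y * φ y ≤ φ x := by
  induction n generalizing x with
  | zero => exact hφ x
  | succ n ih =>
    calc ∑' y, m x * (∑' z, P x z * (m z * pathSum P m n z y)) * φ y
        = ∑' z, m x * P x z * ∑' y, m z * pathSum P m n z y * φ y := by
          simp_rw [← ENNReal.tsum_mul_left, ← ENNReal.tsum_mul_right]
          rw [ENNReal.tsum_comm]
          refine tsum_congr fun w => tsum_congr fun z => ?_
          ring
      _ ≤ ∑' z, m x * P x z * φ z := by
          gcongr with z
          exact ih z
      _ ≤ φ x := hφ x

theorem left_le (hψ : ∀ y, ∑' x, ψ x * (m x * P x y) ≤ ψ y) (hψ0 : ∀ x, ψ x ≠ 0)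
    (hψt : ∀ x, ψ x ≠ ∞) (n : ℕ) (x y : X) :
    m x * pathSum P m n x y ≤ (ψ x)⁻¹ * ψ y := by
  rw [← ENNReal.div_eq_inv_mul, ENNReal.le_div_iff_mul_le (.inl (hψ0 x)) (.inl (hψt x)), mul_comm]
  exact (ENNReal.le_tsum x).trans (tsum_left_le hψ n y)

theorem right_le (hφ : ∀ x, ∑' y, m x * P x y * φ y ≤ φ x) (hφ0 : ∀ x, φ x ≠ 0)
    (hφt : ∀ x, φ x ≠ ∞) (n : ℕ) (x y : X) :
    m x * pathSum P m n x y ≤ (φ y)⁻¹ * φ x := by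
  rw [← ENNReal.div_eq_inv_mul, ENNReal.le_div_iff_mul_le (.inl (hφ0 y)) (.inl (hφt y))]
  exact (ENNReal.le_tsum y).trans (tsum_right_le hφ n x)

/-- If x ∈ F, the path sum is at most ψ(y)/ψ(x), and inserting φ(x)/φ(x) costs only a factor that is
bounded on F; the case y ∈ F is symmetric, through φ. No direct step property is needed. -/
theorem exists_le_of_finite (hψ : ∀ y, ∑' x, ψ x * (m x * P x y) ≤ ψ y) (hψ0 : ∀ x, ψ x ≠ 0)
    (hψt : ∀ x, ψ x ≠ ∞) (hφ : ∀ x, ∑' y, m x * P x y * φ y ≤ φ x) (hφ0 : ∀ x, φ x ≠ 0)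
    (hφt : ∀ x, φ x ≠ ∞) {F : Set X} (hF : F.Finite) :
    ∃ c ≠ ∞, ∀ n x y, x ∈ F ∨ y ∈ F → m x * pathSum P m n x y ≤ c * (φ x * ψ y) := by
  refine ⟨∑ z ∈ hF.toFinset, (φ z)⁻¹ * (ψ z)⁻¹, ?_, ?_⟩
  · exact ENNReal.sum_ne_top.2 fun z _ =>
      ENNReal.mul_ne_top (ENNReal.inv_ne_top.2 (hφ0 z)) (ENNReal.inv_ne_top.2 (hψ0 z))
  · have key : ∀ z ∈ F, (φ z)⁻¹ * (ψ z)⁻¹ ≤ ∑ z ∈ hF.toFinset, (φ z)⁻¹ * (ψ z)⁻¹ :=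
      fun z hz => Finset.single_le_sum (f := fun z => (φ z)⁻¹ * (ψ z)⁻¹)
        (fun _ _ => zero_le) (hF.mem_toFinset.2 hz)
    rintro n x y (h | h)
    · calc m x * pathSum P m n x y ≤ (ψ x)⁻¹ * ψ y := left_le hψ hψ0 hψt n x y
        _ = ((φ x)⁻¹ * φ x) * ((ψ x)⁻¹ * ψ y) := by
            rw [ENNReal.inv_mul_cancel (hφ0 x) (hφt x), one_mul]
        _ = (φ x)⁻¹ * (ψ x)⁻¹ * (φ x * ψ y) := by ring
        _ ≤ _ := mul_le_mul_left (key x h) _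
    · calc m x * pathSum P m n x y ≤ (φ y)⁻¹ * φ x := right_le hφ hφ0 hφt n x y
        _ = ((ψ y)⁻¹ * ψ y) * ((φ y)⁻¹ * φ x) := by
            rw [ENNReal.inv_mul_cancel (hψ0 y) (hψt y), one_mul]
        _ = (φ y)⁻¹ * (ψ y)⁻¹ * (φ x * ψ y) := by ring
        _ ≤ _ := mul_le_mul_left (key y h) _

/-- The product is at most the (k+1)-st power of the larger factor, and this power is one of the two
summands. -/
theorem mul_pow_le_add_pow (a b : ℝ≥0∞) (k : ℕ) : a * b ^ k ≤ a ^ (k + 1) + b ^ (k + 1) := by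
  rcases le_total a b with h | h
  · calc a * b ^ k ≤ b * b ^ k := mul_le_mul_left h _
      _ = b ^ (k + 1) := (pow_succ' b k).symm
      _ ≤ _ := le_add_self
  · calc a * b ^ k ≤ a * a ^ k := by gcongr
      _ = a ^ (k + 1) := (pow_succ' a k).symm
      _ ≤ _ := le_self_add

/-- Under the direct step property, the weight of the intermediate points may be concentrated in
a single one. -/
theorem succ_le_tsum (hdsp : ∀ x y, ∑' z, P x z * P z y ≤ Cs * P x y) (k : ℕ) (x y : X) :
    pathSum P m (k + 1) x y ≤ (2 * Cs) ^ k * ∑' z, P x z * (m z ^ (k + 1) * P z y) := by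
  induction k generalizing x y with
  | zero => simp [pathSum]
  | succ k ih =>
    have e1 : ∑' z, ∑' w, P x z * (m z ^ (k + 2) * (P z w * P w y)) ≤
        Cs * ∑' z, P x z * (m z ^ (k + 2) * P z y) := by
      simp_rw [ENNReal.tsum_mul_left]
      rw [← ENNReal.tsum_mul_left]
      refine ENNReal.tsum_le_tsum fun z => ?_
      calc P x z * (m z ^ (k + 2) * ∑' w, P z w * P w y)
          ≤ P x z * (m z ^ (k + 2) * (Cs * P z y)) := by gcongr; exact hdsp z y
        _ = _ := by ring
    have e2 : ∑' z, ∑' w, (P x z * P z w) * (m w ^ (k + 2) * P w y) ≤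
        Cs * ∑' z, P x z * (m z ^ (k + 2) * P z y) := by
      rw [ENNReal.tsum_comm]
      simp_rw [ENNReal.tsum_mul_right]
      rw [← ENNReal.tsum_mul_left]
      refine ENNReal.tsum_le_tsum fun w => ?_
      calc (∑' z, P x z * P z w) * (m w ^ (k + 2) * P w y)
          ≤ (Cs * P x w) * (m w ^ (k + 2) * P w y) := by gcongr; exact hdsp x w
        _ = _ := by ring
    calc pathSum P m (k + 2) x y
        ≤ ∑' z, P x z * (m z * ((2 * Cs) ^ k * ∑' w, P z w * (m w ^ (k + 1) * P w y))) := by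
          change ∑' z, P x z * (m z * pathSum P m (k + 1) z y) ≤ _
          gcongr with z
          exact ih z y
      _ = (2 * Cs) ^ k * ∑' z, ∑' w, P x z * P z w * P w y * (m z * m w ^ (k + 1)) := by
          simp_rw [← ENNReal.tsum_mul_left]
          refine tsum_congr fun z => tsum_congr fun w => ?_
          ring
      -- Mixed weights are traded for pure powers. In each summand one of z, w then carries no
      -- weight, and the direct step property removes it at the price `Cs`; the two summands give
      -- the factor 2 · `Cs`.
      _ ≤ (2 * Cs) ^ k * ∑' z, ∑' w,
            P x z * P z w * P w y * (m z ^ (k + 2) + m w ^ (k + 2)) := by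
          gcongr with z w
          exact mul_pow_le_add_pow _ _ _
      _ = (2 * Cs) ^ k * (∑' z, ∑' w, P x z * (m z ^ (k + 2) * (P z w * P w y)) +
            ∑' z, ∑' w, (P x z * P z w) * (m w ^ (k + 2) * P w y)) := by
          simp_rw [← ENNReal.tsum_add]
          congr 1
          refine tsum_congr fun z => tsum_congr fun w => ?_
          ring
      _ ≤ (2 * Cs) ^ k * (Cs * ∑' z, P x z * (m z ^ (k + 2) * P z y) +
            Cs * ∑' z, P x z * (m z ^ (k + 2) * P z y)) := by gcongr
      _ = _ := by ring

/-- Decomposition of the paths at the first visit to `D`. -/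
theorem le_add_avoiding {D : Set X} {H : X → ℝ≥0∞} {b : ℝ≥0∞}
    (hD : ∀ n x y, ∑' z, P x z * (D.indicator m z * pathSum P m n z y) ≤ b * (H x * ψ y))
    (hDc : ∀ x, 2 * ∑' z, P x z * (Dᶜ.indicator m z * H z) ≤ H x) (n : ℕ) (x y : X) :
    pathSum P m n x y ≤ 2 * b * (H x * ψ y) + pathSum P (Dᶜ.indicator m) n x y := by
  induction n generalizing x with
  | zero => exact le_add_self
  | succ n ih =>
    have hm : ∀ z, m z = D.indicator m z + Dᶜ.indicator m z := fun z =>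
      (congrFun (Set.indicator_self_add_compl D m) z).symm
    calc ∑' z, P x z * (m z * pathSum P m n z y)
        = ∑' z, P x z * (D.indicator m z * pathSum P m n z y) +
          ∑' z, P x z * (Dᶜ.indicator m z * pathSum P m n z y) := by
          rw [← ENNReal.tsum_add]
          refine tsum_congr fun z => ?_
          conv_lhs => rw [hm z]
          ring
      _ ≤ b * (H x * ψ y) + ∑' z, P x z * (Dᶜ.indicator m z *
            (2 * b * (H z * ψ y) + pathSum P (Dᶜ.indicator m) n z y)) := by
          gcongr with z
          · exact hD n x y
          · exact ih z
      _ = b * (H x * ψ y) + (b * ((2 * ∑' z, P x z * (Dᶜ.indicator m z * H z)) * ψ y) +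
            pathSum P (Dᶜ.indicator m) (n + 1) x y) := by
          congr 1
          simp_rw [pathSum, ← ENNReal.tsum_mul_left, ← ENNReal.tsum_mul_right,
            ← ENNReal.tsum_mul_left, ← ENNReal.tsum_add]
          refine tsum_congr fun z => ?_
          ring
      -- The constant 2b reproduces itself: b from a first intermediate point in D, and half of 2b
      -- from one outside D.
      _ ≤ b * (H x * ψ y) + (b * (H x * ψ y) + pathSum P (Dᶜ.indicator m) (n + 1) x y) := by
          gcongr
          exact hDc x
      _ = _ := by ring

/-- The splitting at D is applied with H = P(·,x₀). The condition on the weights allows either the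
term at z or the term at an endpoint w, since an intermediate point may be controlled by its own
level or only through the endpoint. -/
theorem exists_succ_le (hP0 : ∀ x y, P x y ≠ 0) (hPt : ∀ x y, P x y ≠ ∞)
    (hCt : Cs ≠ ∞) (hdsp : ∀ x y, ∑' z, P x z * P z y ≤ Cs * P x y)
    (hm0 : ∀ x, m x ≠ 0) (hmt : ∀ x, m x ≠ ∞)
    (hψ : ∀ y, ∑' x, ψ x * (m x * P x y) ≤ ψ y) (hψ0 : ∀ x, ψ x ≠ 0)
    (hψt : ∀ x, ψ x ≠ ∞) (hφ : ∀ x, ∑' y, m x * P x y * φ y ≤ φ x) (hφ0 : ∀ x, φ x ≠ 0)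
    (hφt : ∀ x, φ x ≠ ∞) {D : Set X} (hD : D.Finite)
    (hmD : ∀ z, z ∉ D → 2 * Cs * m z ≤ 1) (x₀ : X) :
    ∃ c ≠ ∞, ∀ k x y w, w = x ∨ w = y →
      (∀ z, z ∉ D → (2 * Cs) ^ k * m z ^ (k + 1) ≤ P z x₀ * P x₀ z + P w x₀ * P x₀ w) →
      m x * pathSum P m (k + 1) x y ≤ c * (φ x * ψ y) := by
  have hdsp1 : ∀ x z y, P x z * P z y ≤ Cs * P x y := fun x z y =>
    (ENNReal.le_tsum z).trans (hdsp x y)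
  -- For z ∈ D, the direct step property gives P(x,z) ≤ Cs·P(x,x₀)/P(z,x₀), while the rest of the
  -- path costs at most ψ(y)/ψ(z).
  set b := ∑ z ∈ hD.toFinset, Cs * (P z x₀)⁻¹ * (ψ z)⁻¹ with hb
  have hbt : b ≠ ∞ := ENNReal.sum_ne_top.2 fun z _ => ENNReal.mul_ne_top
    (ENNReal.mul_ne_top hCt (ENNReal.inv_ne_top.2 (hP0 _ _))) (ENNReal.inv_ne_top.2 (hψ0 z))
  have h1 : ∀ n x y, ∑' z, P x z * (D.indicator m z * pathSum P m n z y) ≤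
      b * (P x x₀ * ψ y) := by
    intro n x y
    rw [tsum_eq_sum (s := hD.toFinset), hb, Finset.sum_mul]
    · refine Finset.sum_le_sum fun z hz => ?_
      rw [Set.indicator_of_mem (hD.mem_toFinset.1 hz)]
      have h2 : P x z ≤ Cs * (P z x₀)⁻¹ * P x x₀ := by
        rw [mul_right_comm, ← div_eq_mul_inv,
          ENNReal.le_div_iff_mul_le (.inl (hP0 _ _)) (.inl (hPt _ _))]
        exact hdsp1 _ _ _
      calc P x z * (m z * pathSum P m n z y)
          ≤ (Cs * (P z x₀)⁻¹ * P x x₀) * ((ψ z)⁻¹ * ψ y) := by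
            exact mul_le_mul' h2 (left_le hψ hψ0 hψt n z y)
        _ = _ := by ring
    · intro z hz
      rw [Set.indicator_of_notMem (fun h => hz (hD.mem_toFinset.2 h))]
      simp
  have hind : ∀ z, 2 * Cs * Dᶜ.indicator m z ≤ 1 := by
    intro z
    by_cases h : z ∈ D
    · simp [h]
    · simpa [h] using hmD z h
  have h2 : ∀ x, 2 * ∑' z, P x z * (Dᶜ.indicator m z * P z x₀) ≤ P x x₀ := by
    intro x
    -- Cancelling `Cs` needs it to be nonzero; its vanishing would contradict the positivity of P.
    rcases eq_or_ne Cs 0 with h0 | h0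
    · have := hdsp1 x x x₀
      rw [h0, zero_mul, nonpos_iff_eq_zero, mul_eq_zero] at this
      exact absurd this (by simp [hP0])
    · rw [← ENNReal.mul_le_mul_iff_right h0 hCt]
      refine le_trans ?_ (hdsp x x₀)
      rw [← mul_assoc, ← ENNReal.tsum_mul_left]
      refine ENNReal.tsum_le_tsum fun z => ?_
      calc Cs * 2 * (P x z * (Dᶜ.indicator m z * P z x₀))
          = (2 * Cs * Dᶜ.indicator m z) * (P x z * P z x₀) := by ring
        _ ≤ 1 * (P x z * P z x₀) := by gcongr; exact hind z
        _ = _ := one_mul _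
  set cφ := (φ x₀)⁻¹
  set cψ := (ψ x₀ * m x₀)⁻¹
  have h3 : ∀ x, m x * P x x₀ ≤ cφ * φ x := by
    intro x
    rw [← ENNReal.div_eq_inv_mul, ENNReal.le_div_iff_mul_le (.inl (hφ0 _)) (.inl (hφt _))]
    exact (ENNReal.le_tsum x₀).trans (hφ x)
  have h4 : ∀ y, P x₀ y ≤ cψ * ψ y := by
    intro y
    rw [← ENNReal.div_eq_inv_mul, ENNReal.le_div_iff_mul_le
      (.inl (mul_ne_zero (hψ0 _) (hm0 _))) (.inl (ENNReal.mul_ne_top (hψt _) (hmt _))),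
      mul_comm, mul_assoc]
    exact (ENNReal.le_tsum x₀).trans (hψ y)
  have hcφ : cφ ≠ ∞ := ENNReal.inv_ne_top.2 (hφ0 _)
  have hcψ : cψ ≠ ∞ := ENNReal.inv_ne_top.2 (mul_ne_zero (hψ0 _) (hm0 _))
  -- The first summand accounts for the paths visiting D, the second for those avoiding it.
  refine ⟨2 * b * cφ + 2 * Cs ^ 2 * cφ * cψ, by finiteness, fun k x y w hw hk => ?_⟩
  have h5 : pathSum P (Dᶜ.indicator m) (k + 1) x y ≤ 2 * Cs ^ 2 * (P x x₀ * P x₀ y) := by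
    calc pathSum P (Dᶜ.indicator m) (k + 1) x y
        ≤ (2 * Cs) ^ k * ∑' z, P x z * (Dᶜ.indicator m z ^ (k + 1) * P z y) :=
          succ_le_tsum hdsp k x y
      _ = ∑' z, P x z * (((2 * Cs) ^ k * Dᶜ.indicator m z ^ (k + 1)) * P z y) := by
          rw [← ENNReal.tsum_mul_left]
          refine tsum_congr fun z => ?_
          ring
      _ ≤ ∑' z, P x z * ((P z x₀ * P x₀ z + P w x₀ * P x₀ w) * P z y) := by
          gcongr with z
          by_cases h : z ∈ D
          · simp [h]
          · simpa [h] using hk z h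
      _ = ∑' z, (P x z * P z x₀) * (P x₀ z * P z y) +
            (P w x₀ * P x₀ w) * ∑' z, P x z * P z y := by
          rw [← ENNReal.tsum_mul_left, ← ENNReal.tsum_add]
          refine tsum_congr fun z => ?_
          ring
      -- In the first sum, only the two steps from x₀ through z to y are merged pointwise; the
      -- remaining factor is kept for the summation over z.
      _ ≤ ∑' z, (P x z * P z x₀) * (Cs * P x₀ y) + (P w x₀ * P x₀ w) * (Cs * P x y) := by
          exact add_le_add
            (ENNReal.tsum_le_tsum fun z => mul_le_mul_right (hdsp1 _ _ _) _)
            (mul_le_mul_right (hdsp x y) _)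
      _ ≤ (Cs * P x x₀) * (Cs * P x₀ y) + Cs ^ 2 * (P x x₀ * P x₀ y) := by
          rw [ENNReal.tsum_mul_right]
          refine add_le_add (mul_le_mul_left (hdsp x x₀) _) ?_
          -- Since w is an endpoint, one of the steps between w and x₀ can be joined to P(x,y), and
          -- the direct step property then leaves only P(x,x₀)P(x₀,y).
          rcases hw with rfl | rfl
          · calc P w x₀ * P x₀ w * (Cs * P w y) = Cs * P w x₀ * (P x₀ w * P w y) := by ring
                _ ≤ Cs * P w x₀ * (Cs * P x₀ y) := mul_le_mul_right (hdsp1 _ _ _) _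
                _ = Cs ^ 2 * (P w x₀ * P x₀ y) := by ring
          · calc P w x₀ * P x₀ w * (Cs * P x w) = Cs * P x₀ w * (P x w * P w x₀) := by ring
                _ ≤ Cs * P x₀ w * (Cs * P x x₀) := mul_le_mul_right (hdsp1 _ _ _) _
                _ = Cs ^ 2 * (P x x₀ * P x₀ w) := by ring
      _ = _ := by ring
  calc m x * pathSum P m (k + 1) x y
      ≤ m x * (2 * b * (P x x₀ * ψ y) + 2 * Cs ^ 2 * (P x x₀ * P x₀ y)) := by
        gcongr
        exact (le_add_avoiding h1 h2 (k + 1) x y).trans (by gcongr)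
    _ = 2 * b * ((m x * P x x₀) * ψ y) + 2 * Cs ^ 2 * ((m x * P x x₀) * P x₀ y) := by ring
    _ ≤ 2 * b * ((cφ * φ x) * ψ y) + 2 * Cs ^ 2 * ((cφ * φ x) * (cψ * ψ y)) := by
        exact add_le_add (mul_le_mul_right (mul_le_mul_left (h3 x) _) _)
          (mul_le_mul_right (mul_le_mul' (h3 x) (h4 y)) _)
    _ = _ := by ring

end pathSum

/-! ### From real series to `ℝ≥0∞`, and ground states of kernels in duality. -/

/-- No summability is required, because a divergent real `tsum` is 0. Hence the iterated kernels can
be bounded without first showing that their defining series converge. -/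
theorem ENNReal.ofReal_tsum_le {ι : Type*} {f : ι → ℝ} :
    ENNReal.ofReal (∑' i, f i) ≤ ∑' i, ENNReal.ofReal (f i) := by
  by_cases hf : Summable f
  · have hp : Summable fun i => max (f i) 0 :=
      Summable.of_nonneg_of_le (fun i => le_max_right _ _)
        (fun i => max_le (le_abs_self _) (abs_nonneg _)) hf.abs
    calc ENNReal.ofReal (∑' i, f i) ≤ ENNReal.ofReal (∑' i, max (f i) 0) :=
          ENNReal.ofReal_le_ofReal (hf.tsum_le_tsum (fun i => le_max_left _ _) hp)
      _ = ∑' i, ENNReal.ofReal (max (f i) 0) :=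
          ENNReal.ofReal_tsum_of_nonneg (fun i => le_max_right _ _) hp
      _ = _ := by simp [ENNReal.ofReal_max]
  · simp [tsum_eq_zero_of_not_summable hf]

section GroundState

variable {X : Type*} [Countable X] [MeasurableSpace X] [DiscreteMeasurableSpace X]
  {μ : X → ℝ} {K Khat : X → X → ℝ} {C Chat : ℝ} {φ φhat : X → ℝ}

theorem IsGroundState.hasSum {h : SchurBound μ K C} (hφ : IsGroundState h.toCLM φ) (x : X) :
    HasSum (fun y => K x y * φ y) ((spectralRadius ℂ h.toCLM).toReal * φ x) := by
  obtain ⟨-, hmem, -, heig⟩ := hφ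
  have hcoe : (hmem.toLp : X → ℂ) = fun x => (φ x : ℂ) :=
    eq_of_ae_eq_weightMeasure h.pos hmem.coeFn_toLp
  have hsm := eq_of_ae_eq_weightMeasure h.pos
    (Lp.coeFn_smul ((spectralRadius ℂ h.toCLM).toReal : ℂ) hmem.toLp)
  have h1 := h.toCLM_apply hmem.toLp x
  rw [heig, hsm, hcoe] at h1
  have h2 := (h.summable hmem x).hasSum
  rw [← h1] at h2
  simp only [Pi.smul_apply, smul_eq_mul] at h2
  exact_mod_cast h2

theorem IsGroundState.tsum_ofReal {h : SchurBound μ K C} (hφ : IsGroundState h.toCLM φ) (x : X) :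
    ∑' y, ENNReal.ofReal (K x y) * ENNReal.ofReal (φ y) =
      ENNReal.ofReal (spectralRadius ℂ h.toCLM).toReal * ENNReal.ofReal (φ x) := by
  rw [← ENNReal.ofReal_mul ENNReal.toReal_nonneg, ← (hφ.hasSum x).tsum_eq,
    ENNReal.ofReal_tsum_of_nonneg (fun y => mul_nonneg (h.nonneg x y) (hφ.1 y).le)
      (hφ.hasSum x).summable]
  exact tsum_congr fun y => (ENNReal.ofReal_mul (h.nonneg x y)).symm

theorem IsGroundState.tsum_sq_ne_top {T : ell2 μ →L[ℂ] ell2 μ} (hφ : IsGroundState T φ) :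
    ∑' x, ENNReal.ofReal (μ x) * ENNReal.ofReal (φ x) ^ 2 ≠ ∞ := by
  obtain ⟨hpos, hmem, -⟩ := hφ
  have h := ENNReal.pow_ne_top (n := 2) hmem.2.ne
  rw [eLpNorm_two_sq] at h
  convert h using 5 with x
  rw [← ofReal_norm, Complex.norm_real, Real.norm_of_nonneg (hpos x).le]

/-- The eigenvalues of the ground states of two kernels in duality coincide. -/
theorem IsGroundState.spectralRadius_toReal_eq [Nonempty X] {h : SchurBound μ K C}
    {hhat : SchurBound μ Khat Chat} (hφ : IsGroundState h.toCLM φ)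
    (hφhat : IsGroundState hhat.toCLM φhat) (hdual : ∀ x y, μ x * K x y = μ y * Khat y x) :
    (spectralRadius ℂ h.toCLM).toReal = (spectralRadius ℂ hhat.toCLM).toReal := by
  set I := ∑' x, ENNReal.ofReal (μ x) * (ENNReal.ofReal (φ x) * ENNReal.ofReal (φhat x)) with hI
  have hIt : I ≠ ∞ := by
    -- The pairing of φ and φhat is finite because both are square summable.
    refine ne_top_of_le_ne_top (ENNReal.add_ne_top.2 ⟨hφ.tsum_sq_ne_top, hφhat.tsum_sq_ne_top⟩) ?_
    rw [← ENNReal.tsum_add]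
    refine ENNReal.tsum_le_tsum fun x => ?_
    rw [← mul_add]
    gcongr
    simpa using pathSum.mul_pow_le_add_pow (ENNReal.ofReal (φ x)) (ENNReal.ofReal (φhat x)) 1
  have hI0 : I ≠ 0 := by
    obtain ⟨x⟩ := ‹Nonempty X›
    intro h0
    have := ENNReal.tsum_eq_zero.1 h0 x
    simp only [mul_eq_zero, ENNReal.ofReal_eq_zero] at this
    have := h.pos x
    have := hφ.1 x
    have := hφhat.1 x
    grind
  -- Both sides are the pairing of φhat with the image of φ under the first operator, computed on
  -- either side of the duality. As I is positive and finite, it cancels.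
  have key : ENNReal.ofReal (spectralRadius ℂ h.toCLM).toReal * I =
      ENNReal.ofReal (spectralRadius ℂ hhat.toCLM).toReal * I := by
    calc ENNReal.ofReal (spectralRadius ℂ h.toCLM).toReal * I
        = ∑' x, ∑' y, ENNReal.ofReal (μ x * K x y) *
            (ENNReal.ofReal (φ y) * ENNReal.ofReal (φhat x)) := by
          rw [hI, ← ENNReal.tsum_mul_left]
          refine tsum_congr fun x => ?_
          rw [show ∀ a b c d : ℝ≥0∞, a * (b * (c * d)) = b * d * (a * c) by intros; ring,
            ← hφ.tsum_ofReal, ← ENNReal.tsum_mul_left]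
          refine tsum_congr fun y => ?_
          rw [ENNReal.ofReal_mul (h.pos x).le]
          ring
      _ = ∑' y, ∑' x, ENNReal.ofReal (μ y * Khat y x) *
            (ENNReal.ofReal (φ y) * ENNReal.ofReal (φhat x)) := by
          rw [ENNReal.tsum_comm]
          simp_rw [hdual]
      _ = _ := by
          rw [hI, ← ENNReal.tsum_mul_left]
          refine tsum_congr fun y => ?_
          rw [show ∀ a b c d : ℝ≥0∞, a * (b * (c * d)) = b * c * (a * d) by intros; ring,
            ← hφhat.tsum_ofReal, ← ENNReal.tsum_mul_left]
          refine tsum_congr fun x => ?_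
          rw [ENNReal.ofReal_mul (h.pos y).le]
          ring
  have := (ENNReal.mul_left_inj hI0 hIt).1 key
  rwa [ENNReal.ofReal_eq_ofReal_iff ENNReal.toReal_nonneg ENNReal.toReal_nonneg] at this

end GroundState

/-! ### Exhausting sequences and the index l(n). -/

section Exhausting

variable {X : Type*} {B : ℕ → Set X} {E E' : Set X}

theorem IsExhausting.mono (hB : IsExhausting B) {m n : ℕ} (hm : 1 ≤ m) (hmn : m ≤ n) :
    B m ⊆ B n := by
  induction n, hmn using Nat.le_induction with
  | base => exact subset_rfl
  | succ n hn ih => exact ih.trans (hB.1 n (hm.trans hn))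

theorem IsExhausting.exists_mem (hB : IsExhausting B) (x : X) : ∃ n, 1 ≤ n ∧ x ∈ B n := by
  have h : x ∈ ⋃ n ∈ Set.Ici 1, B n := hB.2 ▸ Set.mem_univ x
  simpa using h

theorem IsExhausting.firstAppearance_spec (hB : IsExhausting B) (x : X) :
    1 ≤ firstAppearance B x ∧ x ∈ B (firstAppearance B x) :=
  Nat.sInf_mem (s := {n | 1 ≤ n ∧ x ∈ B n}) (hB.exists_mem x)

theorem firstAppearance_le {n : ℕ} {x : X} (hn : 1 ≤ n) (hx : x ∈ B n) :
    firstAppearance B x ≤ n :=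
  Nat.sInf_le (s := {n | 1 ≤ n ∧ x ∈ B n}) ⟨hn, hx⟩

theorem extendTop_coe (B : ℕ → Set X) (k : ℕ) : extendTop B k = B k := by
  simp [extendTop]

theorem extendTop_top (B : ℕ → Set X) : extendTop B ⊤ = Set.univ := by
  simp [extendTop]

theorem IsExhausting.extendTop_mono (hB : IsExhausting B) {k l : ℕ∞} (hk : 1 ≤ k) (hkl : k ≤ l) :
    extendTop B k ⊆ extendTop B l := by
  induction l using ENat.recTopCoe with
  | top => simp [extendTop_top]
  | coe l =>
    lift k to ℕ using ne_top_of_le_ne_top (ENat.natCast_ne_top l) hkl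
    rw [extendTop_coe, extendTop_coe]
    exact hB.mono (by exact_mod_cast hk) (by exact_mod_cast hkl)

theorem le_lastIndex {k : ℕ} (hk : 1 ≤ k) (h : B k ⊆ E) : (k : ℕ∞) ≤ lastIndex B E := by
  rw [lastIndex, if_pos ⟨k, hk, h⟩]
  exact le_iSup₂_of_le (f := fun (k : ℕ) (_ : k ∈ {k : ℕ | 1 ≤ k ∧ B k ⊆ E}) => (k : ℕ∞))
    k ⟨hk, h⟩ le_rfl

theorem one_le_lastIndex (B : ℕ → Set X) (E : Set X) : 1 ≤ lastIndex B E := by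
  by_cases h : ∃ k, 1 ≤ k ∧ B k ⊆ E
  · obtain ⟨k, hk, hkE⟩ := h
    exact le_trans (by exact_mod_cast hk) (le_lastIndex hk hkE)
  · rw [lastIndex, if_neg h]

theorem lastIndex_mono (h : E ⊆ E') : lastIndex B E ≤ lastIndex B E' := by
  by_cases hE : ∃ k, 1 ≤ k ∧ B k ⊆ E
  · rw [lastIndex, if_pos hE]
    exact iSup₂_le fun k hk => le_lastIndex hk.1 (hk.2.trans h)
  · rw [lastIndex, if_neg hE]
    exact one_le_lastIndex _ _

/-- The admissible indices are downward closed. If the first appearance of x were not admissible,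
all admissible ones would be strictly smaller, and so would their supremum, even when the latter is
allowed to be ∞. The alternative `B 1` comes from the default value 1 for the empty supremum. -/
theorem IsExhausting.subset_of_mem_extendTop_lastIndex (hB : IsExhausting B) {x : X}
    (hx : x ∈ extendTop B (lastIndex B E)) : x ∈ B 1 ∨ B (firstAppearance B x) ⊆ E := by
  by_cases hE : ∃ k, 1 ≤ k ∧ B k ⊆ E
  · right
    have hle : (firstAppearance B x : ℕ∞) ≤ lastIndex B E := by
      have h1 := one_le_lastIndex B E
      generalize lastIndex B E = l at hx h1
      induction l using ENat.recTopCoe with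
      | top => exact le_top
      | coe l =>
        rw [extendTop_coe] at hx
        exact_mod_cast firstAppearance_le (by exact_mod_cast h1) hx
    by_contra hcon
    have hlt : ∀ k, 1 ≤ k → B k ⊆ E → k < firstAppearance B x := fun k hk hkE => by
      by_contra! hk'
      exact hcon ((hB.mono (hB.firstAppearance_spec x).1 hk').trans hkE)
    have h1 := (hB.firstAppearance_spec x).1
    have : lastIndex B E ≤ (firstAppearance B x - 1 : ℕ) := by
      rw [lastIndex, if_pos hE]
      refine iSup₂_le fun k hk => ?_
      have := hlt k hk.1 hk.2
      exact_mod_cast (by omega : k ≤ firstAppearance B x - 1)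
    have h2 : firstAppearance B x ≤ firstAppearance B x - 1 := by exact_mod_cast hle.trans this
    omega
  · left
    rw [lastIndex, if_neg hE] at hx
    simpa [extendTop] using hx

end Exhausting

/-! ### Feynman-Kac kernels as path sums. -/

namespace FeynmanKac

section Kernels

variable {X : Type*}

theorem P_le_one (S : FeynmanKac X) (x y : X) : S.P x y ≤ 1 :=
  ((S.P_summable x).le_tsum y fun z _ => S.P_nonneg x z).trans (S.P_sum_le x)

theorem one_le_one_div_mul {S : FeynmanKac X} {Cs : ℝ} (hA1 : S.A1 Cs) (x y : X) : 1 ≤ 1 / (S.P x y * S.P y x) := by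
  rw [le_div_iff₀ (mul_pos (hA1.2.1 _ _) (hA1.2.1 _ _)), one_mul]
  exact mul_le_one₀ (S.P_le_one _ _) (S.P_nonneg _ _) (S.P_le_one _ _)

theorem constC_pos {S : FeynmanKac X} {Cs : ℝ} (hA1 : S.A1 Cs) : 0 < S.constC Cs :=
  lt_max_of_lt_left (by linarith [hA1.1])

/-- One step has weight λ·m(x)·P(x,z) with m = 1/(λV). The starting point thus carries its weight
outside the path sum, and the end point carries none. -/
theorem ofReal_u_mul_le (S : FeynmanKac X) {lam : ℝ} (hlam : 0 < lam) (n : ℕ) (x y : X) :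
    ENNReal.ofReal (S.u (n + 1) x y) * ENNReal.ofReal (S.μ y) ≤
      ENNReal.ofReal lam ^ (n + 1) * (ENNReal.ofReal (lam * S.V x)⁻¹ *
        pathSum (fun x y => ENNReal.ofReal (S.P x y))
          (fun x => ENNReal.ofReal (lam * S.V x)⁻¹) n x y) := by
  have hV := S.V_pos
  have hμ := S.μ_pos
  have hstep : ∀ x z, ENNReal.ofReal (S.p x z / S.V x) * ENNReal.ofReal (S.μ z) =
      ENNReal.ofReal lam * (ENNReal.ofReal (lam * S.V x)⁻¹ * ENNReal.ofReal (S.P x z)) := by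
    intro x z
    rw [← ENNReal.ofReal_mul' (hμ z).le, ← ENNReal.ofReal_mul' (S.P_nonneg x z),
      ← ENNReal.ofReal_mul hlam.le]
    congr 1
    have := (hV x).ne'
    have := (hμ z).ne'
    simp only [p]
    field_simp
  induction n generalizing x with
  | zero =>
    rw [zero_add, pow_one]
    exact (hstep x y).le
  | succ n ih =>
    calc ENNReal.ofReal (∑' z, S.p x z / S.V x * S.u (n + 1) z y * S.μ z) * ENNReal.ofReal (S.μ y)
        ≤ (∑' z, ENNReal.ofReal (S.p x z / S.V x * S.u (n + 1) z y * S.μ z)) *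
            ENNReal.ofReal (S.μ y) := by
          gcongr
          exact ENNReal.ofReal_tsum_le
      _ = ∑' z, ENNReal.ofReal lam * (ENNReal.ofReal (lam * S.V x)⁻¹ * ENNReal.ofReal (S.P x z)) *
            (ENNReal.ofReal (S.u (n + 1) z y) * ENNReal.ofReal (S.μ y)) := by
          rw [← ENNReal.tsum_mul_right]
          refine tsum_congr fun z => ?_
          rw [← hstep, ENNReal.ofReal_mul' (hμ z).le, ENNReal.ofReal_mul
            (show 0 ≤ S.p x z / S.V x from div_nonneg (div_nonneg (S.P_nonneg x z) (hμ z).le) (hV x).le)]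
          ring
      _ ≤ ∑' z, ENNReal.ofReal lam * (ENNReal.ofReal (lam * S.V x)⁻¹ * ENNReal.ofReal (S.P x z)) *
            _ := ENNReal.tsum_le_tsum fun z => mul_le_mul_right (ih z) _
      _ = _ := by
          simp_rw [pathSum, ← ENNReal.tsum_mul_left]
          refine tsum_congr fun z => ?_
          ring

/-- Duality reverses the path: the first dual step from y is the last step into y. The induction
therefore moves y and unfolds the path sum from the right. -/
theorem ofReal_uhat_mul_le (S : FeynmanKac X) {lam : ℝ} (hlam : 0 < lam) (n : ℕ) (x y : X) :
    ENNReal.ofReal (S.uhat (n + 1) y x) * ENNReal.ofReal (S.μ y) ≤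
      ENNReal.ofReal lam ^ (n + 1) * (ENNReal.ofReal (lam * S.V x)⁻¹ *
        pathSum (fun x y => ENNReal.ofReal (S.P x y))
          (fun x => ENNReal.ofReal (lam * S.V x)⁻¹) n x y) := by
  have hV := S.V_pos
  have hμ := S.μ_pos
  -- The factor μ(z) is kept on both sides: it is the integration weight in the recursion and puts
  -- the identity in the form of the duality relation.
  have hstep : ∀ y z, ENNReal.ofReal (S.phat y z / S.V z) * ENNReal.ofReal (S.μ y) *
      ENNReal.ofReal (S.μ z) = ENNReal.ofReal lam * (ENNReal.ofReal (lam * S.V z)⁻¹ *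
        ENNReal.ofReal (S.P z y)) * ENNReal.ofReal (S.μ z) := by
    intro y z
    rw [← ENNReal.ofReal_mul' (hμ y).le, ← ENNReal.ofReal_mul' (S.P_nonneg z y),
      ← ENNReal.ofReal_mul hlam.le, ← ENNReal.ofReal_mul' (hμ z).le, ← ENNReal.ofReal_mul' (hμ z).le]
    congr 1
    have := (hV z).ne'
    have := (hμ z).ne'
    have := S.duality z y
    simp only [phat]
    field_simp
    linarith
  induction n generalizing y with
  | zero =>
    have := hstep y x
    rw [ENNReal.mul_left_inj (by simpa using hμ x) ENNReal.ofReal_ne_top] at this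
    rw [zero_add, pow_one]
    exact this.le
  | succ n ih =>
    rw [pathSum.succ_right]
    calc ENNReal.ofReal (∑' z, S.phat y z / S.V z * S.uhat (n + 1) z x * S.μ z) *
          ENNReal.ofReal (S.μ y)
        ≤ (∑' z, ENNReal.ofReal (S.phat y z / S.V z * S.uhat (n + 1) z x * S.μ z)) *
            ENNReal.ofReal (S.μ y) := by
          gcongr
          exact ENNReal.ofReal_tsum_le
      _ = ∑' z, ENNReal.ofReal lam * (ENNReal.ofReal (lam * S.V z)⁻¹ * ENNReal.ofReal (S.P z y)) *
            (ENNReal.ofReal (S.uhat (n + 1) z x) * ENNReal.ofReal (S.μ z)) := by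
          rw [← ENNReal.tsum_mul_right]
          refine tsum_congr fun z => ?_
          rw [mul_comm (ENNReal.ofReal (S.uhat (n + 1) z x)), ← mul_assoc, ← hstep,
            ENNReal.ofReal_mul' (hμ z).le, ENNReal.ofReal_mul
            (show 0 ≤ S.phat y z / S.V z from div_nonneg (div_nonneg (S.Phat_nonneg y z) (hμ z).le) (hV z).le)]
          ring
      _ ≤ ∑' z, ENNReal.ofReal lam * (ENNReal.ofReal (lam * S.V z)⁻¹ * ENNReal.ofReal (S.P z y)) *
            _ := ENNReal.tsum_le_tsum fun z => mul_le_mul_right (ih z) _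
      _ = _ := by
          simp_rw [← ENNReal.tsum_mul_left]
          refine tsum_congr fun z => ?_
          ring

end Kernels

/-! ### Eigenvalue equations, level sets and the final bound. -/

variable {X : Type*} [Countable X] [MeasurableSpace X] [DiscreteMeasurableSpace X]
  {S : FeynmanKac X} {Cs : ℝ} {B : ℕ → Set X} {D : Set X} {x₀ : X} {φ φhat : X → ℝ}

/-- At any point the eigenvalue equation equates λ₀φ with a sum of positive terms. -/
theorem lam0_pos [Nonempty X] (hA1 : S.A1 Cs) (hφ : IsGroundState S.U φ) : 0 < S.lam0 := by
  obtain ⟨x⟩ := ‹Nonempty X›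
  have h := hφ.hasSum (h := S.schurBound_U) x
  have hpos : ∀ y, 0 < S.P x y / S.V x * φ y := fun y =>
    mul_pos (div_pos (hA1.2.1 x y) (S.V_pos x)) (hφ.1 y)
  have := h.summable.tsum_pos (fun y => (hpos y).le) x (hpos x)
  rw [h.tsum_eq] at this
  exact pos_of_mul_pos_left this (hφ.1 x).le

theorem lam0_eq [Nonempty X] (hφ : IsGroundState S.U φ) (hφhat : IsGroundState S.Uhat φhat) :
    S.lam0 = (spectralRadius ℂ S.Uhat).toReal := by
  refine hφ.spectralRadius_toReal_eq (h := S.schurBound_U) (hhat := S.schurBound_Uhat) hφhat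
    fun x y => ?_
  rw [← mul_div_assoc, S.duality, mul_div_assoc]

theorem tsum_right_eq (hlam : 0 < S.lam0) (hφ : IsGroundState S.U φ) (x : X) :
    ∑' y, ENNReal.ofReal (S.lam0 * S.V x)⁻¹ * ENNReal.ofReal (S.P x y) * ENNReal.ofReal (φ y) =
      ENNReal.ofReal (φ x) := by
  have h := hφ.tsum_ofReal (h := S.schurBound_U) x
  have hV := S.V_pos x
  calc _ = ∑' y, ENNReal.ofReal S.lam0⁻¹ * (ENNReal.ofReal (S.P x y / S.V x) *
            ENNReal.ofReal (φ y)) := by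
        refine tsum_congr fun y => ?_
        rw [← ENNReal.ofReal_mul' (S.P_nonneg x y), ← mul_assoc,
          ← ENNReal.ofReal_mul (inv_nonneg.2 hlam.le)]
        congr 2
        field_simp
    _ = ENNReal.ofReal S.lam0⁻¹ * (ENNReal.ofReal S.lam0 * ENNReal.ofReal (φ x)) := by
        rw [ENNReal.tsum_mul_left, h]
        rfl
    _ = _ := by
        rw [← mul_assoc, ← ENNReal.ofReal_mul (inv_nonneg.2 hlam.le), inv_mul_cancel₀ hlam.ne']
        simp

/-- Through duality, the eigenvalue equation for φhat makes φhat·μ a left fixed function of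
m(x)P(x,y). -/
theorem tsum_left_eq [Nonempty X] (hlam : 0 < S.lam0) (hφ : IsGroundState S.U φ)
    (hφhat : IsGroundState S.Uhat φhat) (y : X) :
    ∑' x, ENNReal.ofReal (φhat x * S.μ x) *
      (ENNReal.ofReal (S.lam0 * S.V x)⁻¹ * ENNReal.ofReal (S.P x y)) =
      ENNReal.ofReal (φhat y * S.μ y) := by
  have h := hφhat.tsum_ofReal (h := S.schurBound_Uhat) y
  have hμ := S.μ_pos
  calc _ = ∑' x, ENNReal.ofReal (S.lam0⁻¹ * S.μ y) * (ENNReal.ofReal (S.Phat y x / S.V x) *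
            ENNReal.ofReal (φhat x)) := by
        refine tsum_congr fun x => ?_
        have hV := S.V_pos x
        rw [← ENNReal.ofReal_mul' (S.P_nonneg x y), ← ENNReal.ofReal_mul' (hφhat.1 x).le,
          ← ENNReal.ofReal_mul (mul_nonneg (hφhat.1 x).le (hμ x).le),
          ← ENNReal.ofReal_mul (mul_nonneg (inv_nonneg.2 hlam.le) (hμ y).le)]
        congr 1
        have := S.duality x y
        field_simp
        linear_combination φhat x * this
    _ = ENNReal.ofReal (S.lam0⁻¹ * S.μ y) * (ENNReal.ofReal S.lam0 * ENNReal.ofReal (φhat y)) := by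
        rw [ENNReal.tsum_mul_left, h, lam0_eq hφ hφhat]
        rfl
    _ = _ := by
        rw [← ENNReal.ofReal_mul hlam.le, ← ENNReal.ofReal_mul
          (mul_nonneg (inv_nonneg.2 hlam.le) (hμ y).le)]
        congr 1
        field_simp

/-- The base 1/(P(z,x₀)P(x₀,z)) is at least 1, so its power decreases as the exponent 1/(n-1) does.
-/
theorem levelSet_mono (hA1 : S.A1 Cs) {n : ℕ} (hn : 2 ≤ n) :
    S.levelSet Cs D x₀ n ⊆ S.levelSet Cs D x₀ (n + 1) := by
  refine Set.union_subset_union_right D fun z hz => ?_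
  refine le_trans (b := S.constC Cs * (1 / (S.P z x₀ * S.P x₀ z)) ^ (1 / ((n : ℝ) - 1))) ?_ hz
  have hn' : (2 : ℝ) ≤ n := by exact_mod_cast hn
  refine mul_le_mul_of_nonneg_left ?_ (constC_pos hA1).le
  refine Real.rpow_le_rpow_of_exponent_le (one_le_one_div_mul hA1 z x₀) ?_
  push_cast
  exact one_div_le_one_div_of_le (by linarith) (by linarith)

/-- Outside D the inequality λ₀V(z) > C is strict, while the threshold tends to C as the exponent
tends to 0. -/
theorem eventually_mem_levelSet (hA1 : S.A1 Cs) (hD : {z | S.lam0 * S.V z ≤ S.constC Cs} ⊆ D)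
    (z : X) : ∀ᶠ n in Filter.atTop, z ∈ S.levelSet Cs D x₀ n := by
  by_cases hz : z ∈ D
  · exact Filter.Eventually.of_forall fun n => Or.inl hz
  · have hlt : S.constC Cs * 1 < S.lam0 * S.V z := by
      rw [mul_one]
      exact not_le.1 fun h => hz (hD h)
    have h1 : Filter.Tendsto (fun n : ℕ => 1 / ((n : ℝ) - 1)) Filter.atTop (nhds 0) := by
      simp_rw [one_div]
      exact Filter.Tendsto.inv_tendsto_atTop
        (Filter.tendsto_atTop_add_const_right _ (-1) tendsto_natCast_atTop_atTop)
    have h2 := (Real.continuousAt_const_rpow (b := 0)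
      (zero_lt_one.trans_le (one_le_one_div_mul hA1 z x₀)).ne').tendsto.comp h1
    rw [Real.rpow_zero] at h2
    filter_upwards [(h2.const_mul (S.constC Cs)).eventually_lt_const hlt] with n hn
    exact Or.inr hn.le

theorem isExhausting_exhaustion (hA1 : S.A1 Cs) (hBexh : IsExhausting B)
    (hBfin : ∀ n, 1 ≤ n → (B n).Finite) (hD : {z | S.lam0 * S.V z ≤ S.constC Cs} ⊆ D) :
    IsExhausting (S.exhaustion Cs B D x₀) := by
  constructor
  · intro n hn
    rw [exhaustion, exhaustion, if_neg (by omega : ¬ n + 1 ≤ 1)]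
    split_ifs with h
    · have : B 1 = extendTop B 1 := (extendTop_coe B 1).symm
      rw [this]
      exact hBexh.extendTop_mono le_rfl (one_le_lastIndex _ _)
    · exact hBexh.extendTop_mono (one_le_lastIndex _ _)
        (lastIndex_mono (levelSet_mono hA1 (by omega)))
  · refine Set.eq_univ_of_forall fun x => ?_
    obtain ⟨k, hk, hx⟩ := hBexh.exists_mem x
    -- Finiteness of `B k` yields one n that works for all its points.
    have h1 : ∀ᶠ n in Filter.atTop, ∀ z ∈ B k, z ∈ S.levelSet Cs D x₀ n :=
      (Filter.eventually_all_finite (hBfin k hk)).2 fun z _ => eventually_mem_levelSet hA1 hD z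
    obtain ⟨n, hn, hn2⟩ := (h1.and (Filter.eventually_ge_atTop 2)).exists
    refine Set.mem_iUnion₂.2 ⟨n, Set.mem_Ici.2 (by omega), ?_⟩
    rw [exhaustion, if_neg (by omega)]
    refine hBexh.extendTop_mono (k := k) (by exact_mod_cast hk) (le_lastIndex hk hn) ?_
    rwa [extendTop_coe]

/-- With n = k + 2 the exponent is 1/(k+1), so raising the level condition to the power k + 1
removes the root. The bound (2Cs)^k ≤ C^(k+1) uses both 2Cs ≥ 1 and C ≥ 2Cs. -/
theorem pow_mul_inv_pow_le (hA1 : S.A1 Cs) {k : ℕ} {z : X} (hlam : 0 < S.lam0)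
    (hz : z ∈ S.levelSet Cs D x₀ (k + 2)) (hzD : z ∉ D) :
    (2 * Cs) ^ k * ((S.lam0 * S.V z)⁻¹) ^ (k + 1) ≤ S.P z x₀ * S.P x₀ z := by
  have hz' : S.constC Cs * (1 / (S.P z x₀ * S.P x₀ z)) ^ (1 / (((k + 2 : ℕ) : ℝ) - 1)) ≤
      S.lam0 * S.V z := hz.resolve_left hzD
  have hC := constC_pos hA1
  have hq : 0 < S.P z x₀ * S.P x₀ z := mul_pos (hA1.2.1 _ _) (hA1.2.1 _ _)
  have hs : 0 < S.lam0 * S.V z := mul_pos hlam (S.V_pos z)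
  have h1 := pow_le_pow_left₀ (by positivity) hz' (k + 1)
  rw [mul_pow, ← Real.rpow_natCast (_ ^ _) (k + 1), ← Real.rpow_mul (by positivity)] at h1
  have he : 1 / (((k + 2 : ℕ) : ℝ) - 1) * ((k + 1 : ℕ) : ℝ) = 1 := by
    push_cast
    have : (k : ℝ) + 1 ≠ 0 := by positivity
    rw [show (k : ℝ) + 2 - 1 = k + 1 by ring]
    field_simp
  rw [he, Real.rpow_one] at h1
  have h2 : (2 * Cs) ^ k ≤ S.constC Cs ^ (k + 1) := by
    have h3 : 2 * Cs ≤ S.constC Cs := le_trans (by linarith [hA1.1]) (le_max_left _ _)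
    have h4 := hA1.1
    exact (pow_le_pow_right₀ (by linarith) (Nat.le_succ k)).trans
      (pow_le_pow_left₀ (by linarith) h3 _)
  rw [inv_pow, ← div_eq_mul_inv, div_le_iff₀ (by positivity)]
  refine h2.trans ?_
  rw [mul_one_div, div_le_iff₀ hq] at h1
  linarith

/-- The two kernels are treated together, with arguments exchanged in the dual one, because both are
dominated by the same path sum. -/
theorem exists_bound [Nonempty X] (hA1 : S.A1 Cs)
    (hφ : IsGroundState S.U φ) (hφhat : IsGroundState S.Uhat φhat)
    (hBexh : IsExhausting B) (hBfin : ∀ n, 1 ≤ n → (B n).Finite)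
    (hBinc : IncreasingAlong S.V B)
    (hDfin : D.Finite) (hD : {z | S.lam0 * S.V z ≤ S.constC Cs} ⊆ D) :
    ∃ c : ℝ, 0 < c ∧ ∀ n, 1 ≤ n → ∀ x y,
      x ∈ S.exhaustion Cs B D x₀ n ∨ y ∈ S.exhaustion Cs B D x₀ n →
        S.u n x y ≤ c * S.lam0 ^ n * φ x * φhat y ∧
        S.uhat n y x ≤ c * S.lam0 ^ n * φ x * φhat y := by
  have hlam := lam0_pos hA1 hφ
  have hV := S.V_pos
  have hμ := S.μ_pos
  have hCs : 0 < Cs := by linarith [hA1.1]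
  set P : X → X → ℝ≥0∞ := fun x y => ENNReal.ofReal (S.P x y) with hP
  set m : X → ℝ≥0∞ := fun x => ENNReal.ofReal (S.lam0 * S.V x)⁻¹ with hm
  have hdsp : ∀ x y, ∑' z, P x z * P z y ≤ ENNReal.ofReal Cs * P x y := by
    intro x y
    have hsum : Summable fun z => S.P x z * S.P z y :=
      Summable.of_nonneg_of_le (fun z => mul_nonneg (S.P_nonneg _ _) (S.P_nonneg _ _))
        (fun z => mul_le_of_le_one_right (S.P_nonneg _ _) (S.P_le_one _ _)) (S.P_summable x)
    rw [← ENNReal.ofReal_mul hCs.le]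
    refine le_trans (le_of_eq ?_) (ENNReal.ofReal_le_ofReal (hA1.2.2 x y))
    rw [ENNReal.ofReal_tsum_of_nonneg
      (fun z => mul_nonneg (S.P_nonneg _ _) (S.P_nonneg _ _)) hsum]
    exact tsum_congr fun z => (ENNReal.ofReal_mul (S.P_nonneg _ _)).symm
  have hψ := fun y => (tsum_left_eq hlam hφ hφhat y).le
  have hφ' := fun x => (tsum_right_eq hlam hφ x).le
  have hψ0 : ∀ x, ENNReal.ofReal (φhat x * S.μ x) ≠ 0 := fun x => by
    simpa using mul_pos (hφhat.1 x) (hμ x)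
  have hφ0 : ∀ x, ENNReal.ofReal (φ x) ≠ 0 := fun x => by simpa using hφ.1 x
  have hP0 : ∀ x y, P x y ≠ 0 := fun x y => by simpa [hP] using hA1.2.1 x y
  have hm0 : ∀ x, m x ≠ 0 := fun x => by
    simpa only [hm, ne_eq, ENNReal.ofReal_eq_zero, not_le, inv_pos] using mul_pos hlam (hV x)
  have two_mul_ofReal : 2 * ENNReal.ofReal Cs = ENNReal.ofReal (2 * Cs) := by
    rw [ENNReal.ofReal_mul (by norm_num), ENNReal.ofReal_ofNat]
  -- The finite set D ∪ `B 1` disposes of the endpoints in D, of n = 1, and of the default case l(n)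
  -- = 1.
  obtain ⟨c₁, hc₁, h₁⟩ := pathSum.exists_le_of_finite (P := P) (m := m) hψ hψ0
    (fun _ => ENNReal.ofReal_ne_top) hφ' hφ0 (fun _ => ENNReal.ofReal_ne_top)
    (hDfin.union (hBfin 1 le_rfl))
  obtain ⟨c₂, hc₂, h₂⟩ := pathSum.exists_succ_le (P := P) (m := m) hP0
    (fun _ _ => ENNReal.ofReal_ne_top) ENNReal.ofReal_ne_top hdsp hm0
    (fun _ => ENNReal.ofReal_ne_top) hψ hψ0
    (fun _ => ENNReal.ofReal_ne_top) hφ' hφ0 (fun _ => ENNReal.ofReal_ne_top) hDfin (by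
      intro z hz
      have h3 : S.constC Cs < S.lam0 * S.V z := not_le.1 fun h => hz (hD h)
      have h4 : 3 * Cs ≤ S.constC Cs := le_max_left _ _
      rw [two_mul_ofReal, ← ENNReal.ofReal_mul (by positivity), ENNReal.ofReal_le_one,
        ← div_eq_mul_inv, div_le_one (mul_pos hlam (hV z))]
      linarith) x₀
  have hkey : ∀ n x y, x ∈ S.exhaustion Cs B D x₀ (n + 1) ∨ y ∈ S.exhaustion Cs B D x₀ (n + 1) →
      m x * pathSum P m n x y ≤
        (c₁ + c₂) * (ENNReal.ofReal (φ x) * ENNReal.ofReal (φhat y * S.μ y)) := by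
    intro n x y hxy
    by_cases hF : x ∈ D ∪ B 1 ∨ y ∈ D ∪ B 1
    · exact (h₁ n x y hF).trans (mul_le_mul_left le_self_add _)
    push Not at hF
    obtain ⟨w, hw, hwA, hwF⟩ : ∃ w, (w = x ∨ w = y) ∧ w ∈ S.exhaustion Cs B D x₀ (n + 1) ∧
        w ∉ D ∪ B 1 := by
      rcases hxy with h | h
      · exact ⟨x, .inl rfl, h, hF.1⟩
      · exact ⟨y, .inr rfl, h, hF.2⟩
    rw [Set.mem_union, not_or] at hwF
    rw [exhaustion] at hwA
    cases n with
    | zero => exact absurd hwA (by simpa using hwF.2)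
    | succ k =>
      rw [if_neg (by omega)] at hwA
      have hsub := (hBexh.subset_of_mem_extendTop_lastIndex hwA).resolve_left hwF.2
      have hlev : ∀ z, z ∈ S.levelSet Cs D x₀ (k + 2) → z ∉ D →
          ENNReal.ofReal ((2 * Cs) ^ k * ((S.lam0 * S.V z)⁻¹) ^ (k + 1)) ≤ P z x₀ * P x₀ z := by
        intro z hz hzD
        rw [hP, ← ENNReal.ofReal_mul (S.P_nonneg _ _)]
        exact ENNReal.ofReal_le_ofReal (pow_mul_inv_pow_le hA1 hlam hz hzD)
      refine (h₂ k x y w hw fun z hz => ?_).trans (mul_le_mul_left le_add_self _)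
      rw [two_mul_ofReal, ← ENNReal.ofReal_pow (by positivity),
        ← ENNReal.ofReal_pow (inv_nonneg.2 (mul_pos hlam (hV z)).le),
        ← ENNReal.ofReal_mul (by positivity)]
      -- If V(w) ≤ V(z), the weight at z is at most that at w, and w is in the level set. Otherwise
      -- monotonicity of V forces z to appear no later than w, so z itself is in the level set.
      by_cases hzw : S.V w ≤ S.V z
      · refine le_trans (ENNReal.ofReal_le_ofReal ?_) ((hlev w
          (hsub (hBexh.firstAppearance_spec w).2) hwF.1).trans le_add_self)
        have := hV w
        have := hV z
        gcongr
      · have hfa : firstAppearance B z ≤ firstAppearance B w := by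
          by_contra! h
          exact hzw (hBinc w z h)
        exact (hlev z (hsub (hBexh.mono (hBexh.firstAppearance_spec z).1 hfa
          (hBexh.firstAppearance_spec z).2)) hz).trans le_self_add
  have hreal : ∀ (a : ℝ) n x y,
      ENNReal.ofReal a * ENNReal.ofReal (S.μ y) ≤
        ENNReal.ofReal S.lam0 ^ (n + 1) * (m x * pathSum P m n x y) →
      m x * pathSum P m n x y ≤
        (c₁ + c₂) * (ENNReal.ofReal (φ x) * ENNReal.ofReal (φhat y * S.μ y)) →
      a ≤ ((c₁ + c₂).toReal + 1) * S.lam0 ^ (n + 1) * φ x * φhat y := by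
    intro a n x y h3 h4
    have hφx := hφ.1 x
    have hφy := hφhat.1 y
    have h5 := h3.trans (mul_le_mul_right h4 _)
    rw [← ENNReal.ofReal_toReal (ENNReal.add_ne_top.2 ⟨hc₁, hc₂⟩),
      ← ENNReal.ofReal_mul hφx.le, ← ENNReal.ofReal_mul ENNReal.toReal_nonneg,
      ← ENNReal.ofReal_pow hlam.le, ← ENNReal.ofReal_mul (pow_nonneg hlam.le _),
      ← ENNReal.ofReal_mul' (hμ y).le, ENNReal.ofReal_le_ofReal_iff
        (by have := hμ y; positivity)] at h5
    have h6 : a ≤ (c₁ + c₂).toReal * S.lam0 ^ (n + 1) * φ x * φhat y := by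
      refine le_of_mul_le_mul_right (h5.trans_eq ?_) (hμ y)
      ring
    refine h6.trans ?_
    gcongr
    linarith
  refine ⟨(c₁ + c₂).toReal + 1, by positivity, fun n hn x y hxy => ?_⟩
  obtain ⟨n, rfl⟩ := Nat.exists_eq_add_of_le' hn
  exact ⟨hreal _ n x y (S.ofReal_u_mul_le hlam n x y) (hkey n x y hxy),
    hreal _ n x y (S.ofReal_uhat_mul_le hlam n x y) (hkey n x y hxy)⟩

end FeynmanKac

theorem mainTheorem2 {X : Type*} [Countable X] [Infinite X] [MeasurableSpace X]
    [DiscreteMeasurableSpace X] (S : FeynmanKac X) (Cs : ℝ)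
    (hA1 : S.A1 Cs) (hA2 : S.A2) (hA3 : S.A3) (hB : S.Confining)
    (φ φhat : X → ℝ) (hφ : IsGroundState S.U φ) (hφhat : IsGroundState S.Uhat φhat)
    (B : ℕ → Set X) (hBexh : IsExhausting B) (hBfin : ∀ n, 1 ≤ n → (B n).Finite)
    (hBinc : IncreasingAlong S.V B) (x₀ : X)
    (D : Set X) (hDfin : D.Finite) (hD : {z | S.lam0 * S.V z ≤ S.constC Cs} ⊆ D) :
    IsExhausting (S.exhaustion Cs B D x₀) ∧
    (∃ c : ℝ, 0 < c ∧ ∀ n, 1 ≤ n → ∀ x y,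
      x ∈ S.exhaustion Cs B D x₀ n ∨ y ∈ S.exhaustion Cs B D x₀ n →
        S.u n x y ≤ c * S.lam0 ^ n * φ x * φhat y) ∧
    IsPIUCAlong (S.exhaustion Cs B D x₀) S.u S.lam0 φ φhat ∧
    IsPIUCAlong (S.exhaustion Cs B D x₀) S.uhat S.lam0 φhat φ := by
  have hexh : IsExhausting (S.exhaustion Cs B D x₀) :=
    FeynmanKac.isExhausting_exhaustion hA1 hBexh hBfin hD
  obtain ⟨c, hc, h⟩ := FeynmanKac.exists_bound (x₀ := x₀) hA1 hφ hφhat hBexh hBfin hBinc hDfin hD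
  refine ⟨hexh, ⟨c, hc, fun n hn x y hxy => (h n hn x y hxy).1⟩,
    ⟨hexh, 1, le_rfl, c, hc, fun n hn x hx y => (h n hn x y (.inl hx)).1⟩,
    ⟨hexh, 1, le_rfl, c, hc, fun n hn x hx y => ?_⟩⟩
  -- The dual statement is the transposed bound, with the condition now on the second argument.
  exact (h n hn y x (.inr hx)).2.trans_eq (by ring)
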